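/- **Setup.** Let $\mathcal S$ be a triangulated category with suspension $\Sigma$. A *good metric* on $\mathcal S$ is a sequence $\{\mathcal M_i\}_{i\in\mathbb N}$ of full subcategories with $0\in\mathcal M_i$, $\mathcal M_i*\mathcal M_i\subset\mathcal M_i$ and $\Sigma^{-1}\mathcal M_{i+1}\cup\mathcal M_{i+1}\cup\Sigma\mathcal M_{i+1}\subset\mathcal M_i$. A sequence $a_*=(a_1\to a_2\to\cdots)$ in $\mathcal S$ is *Cauchy* if for every $n$ there is $N$ such that for all $j\ge i\ge N$ the cone of $a_i\to a_j$ lies in $\mathcal M_n$. Let $Y:\mathcal S\to\mathrm{Mod}\text{-}\mathcal S$ be the Yoneda functor into the category of additive functors $\mathcal S^{op}\to\mathrm{Ab}$. Let $\mathfrak L(\mathcal S)\subset\mathrm{Mod}\text{-}\mathcal S$ consist of the colimits $\operatorname{colim}Y(a_*)$ of Cauchy sequences $a_*$, let $\mathcal L_n\subset\mathfrak L(\mathcal S)$ consist of those with $a_*$ contained in $\mathcal M_n$, and let $\mathfrak S(\mathcal S)=\mathfrak L(\mathcal S)\cap\bigcup_nY(\mathcal M_n)^\perp$; here $\mathcal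 A^\perp$ is the class of $X$ with $\mathrm{Hom}(\mathcal A,X)=0$, and ${}^\perp\mathcal A$ is the class of $X$ with $\mathrm{Hom}(X,\mathcal A)=0$. A map $f_*:a_*\to b_*$ of Cauchy sequences is a *type-$n$ morphism* if in every completion to a sequence of distinguished triangles $a_*\to b_*\to c_*\to\Sigma a_*$ with $c_*$ Cauchy one has $c_i\in\mathcal M_n$ for $i\gg0$. A morphism $F:\operatorname{colim}Y(a_*)\to\operatorname{colim}Y(b_*)$ is *of type-$n$ with respect to $(a_*,b_*)$* if $F=\operatorname{colim}Y(f_*)$ for some type-$n$ morphism $f_*$ from a subsequence of $a_*$ to a subsequence of $b_*$. The metric is *very good* if 1. $\mathcal S=\bigcup_i{}^\perp\mathcal M_i$, and 2. for every $m$ there is $n>m$ such that every $F\in\mathcal S$ admits a distinguished triangle $E\to F\to D\to\Sigma E$ in $\mathcal S$ with $E\in{}^\perp\mathcal M_n$ and $D\in\mathcal M_m$. It is *excellent* if moreover 3. for every $m$ there is $n>m$ such that every $F\in\mathcal S$ admits a Cauchy sequence $d_*$ with $D=\operatorname{colim}Y(d_*)\in\mathfrak S(\mathcal S)\cap\mathcal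 L_n^\perp$ and a morphism $Y(F)\to D$ of type-$m$ with respect to $(F,d_*)$, where $F$ also denotes the constant sequence. **Proposition.** Let $\mathcal T$ be a triangulated category with countable coproducts and a t-structure $(\mathcal T^{\le0},\mathcal T^{\ge0})$ that is nondegenerate, that is, $\bigcap_n\mathcal T^{\le n}=0=\bigcap_n\mathcal T^{\ge n}$. Assume there is an integer $r>0$ such that $\coprod_{i\in\mathbb N}X_i\in\mathcal T^{\ge0}$ for every countable family $\{X_i\}_{i\in\mathbb N}$ of objects of $\mathcal T^{\ge r}$. Put $\mathcal T^-=\bigcup_n\mathcal T^{\le n}$, $\mathcal T^+=\bigcup_n\mathcal T^{\ge -n}$ and $\mathcal T^b=\mathcal T^-\cap\mathcal T^+$. (a) The metric $\{\mathcal T^b\cap\mathcal T^{\ge i}\}_{i\in\mathbb N}$ on $\mathcal T^b$ is very good, and it is excellent if and only if there is an integer $n>1$ such that every $B\in\mathcal T^b\cap\mathcal T^{\ge0}$ admits in $\mathcal T$ a distinguished triangle $A\to B\to C\to\Sigma A$ with $A\in\mathcal T^{\ge1}$ and $C\in\mathcal T^+\cap(\mathcal T^{\ge n})^\perp$. (b)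 The metric $\{\mathcal T^-\cap\mathcal T^{\ge i}\}_{i\in\mathbb N}$ on $\mathcal T^-$ is very good, and it is excellent if and only if there is an integer $n>1$ such that every $B\in\mathcal T^-$ admits in $\mathcal T$ a distinguished triangle $A\to B\to C\to\Sigma A$ with $A\in\mathcal T^{\ge1}$ and $C\in(\mathcal T^{\ge n})^\perp$. -/

import Mathlib

open CategoryTheory CategoryTheory.Limits CategoryTheory.Pretriangulated
  CategoryTheory.Triangulated

universe v u

noncomputable section

/-- A good metric on a triangulated category `S`: a sequence of full subcategories
`M₀, M₁, M₂, …` (`ball i` is `Mᵢ`) containing `0`, with `Mᵢ * Mᵢ ⊆ Mᵢ` and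
`Σ⁻¹ Mᵢ₊₁ ∪ Mᵢ₊₁ ∪ Σ Mᵢ₊₁ ⊆ Mᵢ`. -/
structure GoodMetric (S : Type u) [Category.{v} S] [Preadditive S] [HasZeroObject S]
    [HasShift S ℤ] [∀ n : ℤ, (shiftFunctor S n).Additive] [Pretriangulated S] where
  /-- the subcategory `Mᵢ` -/
  ball : ℕ → ObjectProperty S
  zero_mem : ∀ (i : ℕ) (Z : S), IsZero Z → ball i Z
  ext_mem : ∀ (i : ℕ) (T : Triangle S), T ∈ distTriang S →
    ball i T.obj₁ → ball i T.obj₃ → ball i T.obj₂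
  anti : ∀ (i : ℕ) (X : S), ball (i + 1) X → ball i X
  shift_mem : ∀ (i : ℕ) (X : S), ball (i + 1) X → ball i (X⟦(1 : ℤ)⟧)
  shift_neg_mem : ∀ (i : ℕ) (X : S), ball (i + 1) X → ball i (X⟦(-1 : ℤ)⟧)

/-- The category `Mod-S` of additive functors `Sᵒᵖ ⥤ Ab`. -/
abbrev ModCat (S : Type u) [Category.{v} S] [Preadditive S] : Type (max u (v + 1)) :=
  Sᵒᵖ ⥤+ AddCommGrpCat.{v}

/-- The Yoneda functor `Y : S ⥤ Mod-S`, `X ↦ Hom(-, X)`. -/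
def yonedaMod (S : Type u) [Category.{v} S] [Preadditive S] : S ⥤ ModCat S :=
  ObjectProperty.lift _ preadditiveYoneda
    (fun X => (inferInstance : (preadditiveYoneda.obj X).Additive))

namespace GoodMetric

variable {S : Type u} [Category.{v} S] [Preadditive S] [HasZeroObject S] [HasShift S ℤ]
  [∀ n : ℤ, (shiftFunctor S n).Additive] [Pretriangulated S] (M : GoodMetric S)

/-- The sequence `a₀ ⟶ a₁ ⟶ a₂ ⟶ ⋯` is Cauchy: for every `n` there is `N` such that, for all
`j ≥ i ≥ N`, every distinguished triangle `aᵢ ⟶ aⱼ ⟶ D ⟶ Σ aᵢ` has `D ∈ Mₙ`. -/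
def IsCauchy (a : ℕ ⥤ S) : Prop :=
  ∀ n : ℕ, ∃ N : ℕ, ∀ (i j : ℕ) (hij : i ≤ j), N ≤ i →
    ∀ (D : S) (g : a.obj j ⟶ D) (h : D ⟶ (a.obj i)⟦(1 : ℤ)⟧),
      Triangle.mk (a.map (homOfLE hij)) g h ∈ distTriang S → M.ball n D

/-- The completion `𝔏(S) ⊆ Mod-S`: the colimits of `Y(a)`, for `a` a Cauchy sequence in `S`. -/
def completion : ObjectProperty (ModCat S) := fun X =>
  ∃ a : ℕ ⥤ S, M.IsCauchy a ∧
    ∃ α : (a ⋙ yonedaMod S) ⟶ (Functor.const ℕ).obj X, Nonempty (IsColimit (Cocone.mk X α))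

/-- The subcategory `𝓛ₙ ⊆ 𝔏(S)`: the colimits of `Y(a)`, for `a` a Cauchy sequence contained
in `Mₙ`. -/
def completionBall (n : ℕ) : ObjectProperty (ModCat S) := fun X =>
  ∃ a : ℕ ⥤ S, M.IsCauchy a ∧ (∀ i, M.ball n (a.obj i)) ∧
    ∃ α : (a ⋙ yonedaMod S) ⟶ (Functor.const ℕ).obj X, Nonempty (IsColimit (Cocone.mk X α))

/-- The subcategory `𝔖(S) = 𝔏(S) ∩ ⋃ₙ Y(Mₙ)^⊥` of `Mod-S`. -/
def compactlySupported : ObjectProperty (ModCat S) := fun X =>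
  M.completion X ∧
    ∃ n : ℕ, ∀ m : S, M.ball n m → ∀ f : (yonedaMod S).obj m ⟶ X, f = 0

/-- A map `f : a ⟶ b` of Cauchy sequences is a type-`n` morphism if, in every completion to a
Cauchy sequence of distinguished triangles `a ⟶ b ⟶ c ⟶ Σ a`, one has `cᵢ ∈ Mₙ` for all
`i ≫ 0`. -/
def IsTypeSeq (n : ℕ) {a b : ℕ ⥤ S} (f : a ⟶ b) : Prop :=
  ∀ (c : ℕ ⥤ S) (g : b ⟶ c) (h : c ⟶ a ⋙ shiftFunctor S (1 : ℤ)), M.IsCauchy c →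
    (∀ i, Triangle.mk (f.app i) (g.app i) (h.app i) ∈ distTriang S) →
    ∃ N : ℕ, ∀ i, N ≤ i → M.ball n (c.obj i)

/-- Let `a`, `b` be Cauchy sequences, with colimits `A = colim Y(a)` and `B = colim Y(b)` in
`Mod-S` exhibited by the cocones `α`, `β`. A morphism `F : A ⟶ B` is of type-`n` with respect
to `(a, b)` if there are subsequences `a'` of `a` and `b'` of `b` and a type-`n` morphism
`f : a' ⟶ b'` with `F = colim Y(f)`. -/
def IsType (n : ℕ) {a b : ℕ ⥤ S} (α : Cocone (a ⋙ yonedaMod S)) (β : Cocone (b ⋙ yonedaMod S))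
    (F : α.pt ⟶ β.pt) : Prop :=
  ∃ (p q : ℕ → ℕ) (hp : StrictMono p) (hq : StrictMono q)
    (f : hp.monotone.functor ⋙ a ⟶ hq.monotone.functor ⋙ b),
    (∀ i, α.ι.app (p i) ≫ F = (yonedaMod S).map (f.app i) ≫ β.ι.app (q i)) ∧ M.IsTypeSeq n f

/-- The constant sequence `B = B = B = ⋯`. -/
abbrev constSeq (B : S) : ℕ ⥤ S := (Functor.const ℕ).obj B

/-- `Y(B)` as the colimit of `Y` of the constant sequence at `B`. -/
abbrev constCocone (B : S) : Cocone (constSeq B ⋙ yonedaMod S) :=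
  (yonedaMod S).mapCocone (Cocone.mk B (𝟙 (constSeq B)))

/-- Very good metrics. -/
structure IsVeryGood : Prop where
  exists_leftOrthogonal : ∀ F : S, ∃ i : ℕ, (M.ball i).leftOrthogonal F
  exists_triangle : ∀ m : ℕ, ∃ n : ℕ, m < n ∧ ∀ F : S,
    ∃ (E D : S) (f : E ⟶ F) (g : F ⟶ D) (h : D ⟶ E⟦(1 : ℤ)⟧),
      Triangle.mk f g h ∈ distTriang S ∧ (M.ball n).leftOrthogonal E ∧ M.ball m D

/-- Excellent metrics: very good metrics such that for every `m` there is `n > m` for which every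
`F ∈ S` admits a morphism `φ : Y(F) ⟶ D` with `D = colim Y(d)`, `d` a Cauchy sequence,
`D ∈ 𝔖(S) ∩ 𝓛ₙ^⊥` and `φ` of type-`m` with respect to `(F, d)`, where `F` also denotes the
constant sequence. -/
structure IsExcellent : Prop extends M.IsVeryGood where
  exists_type : ∀ m : ℕ, ∃ n : ℕ, m < n ∧ ∀ F : S,
    ∃ (d : ℕ ⥤ S) (δ : Cocone (d ⋙ yonedaMod S)),
      M.IsCauchy d ∧ Nonempty (IsColimit δ) ∧
      M.compactlySupported δ.pt ∧ (M.completionBall n).rightOrthogonal δ.pt ∧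
      ∃ φ : (constCocone F).pt ⟶ δ.pt, M.IsType m (constCocone F) δ φ

end GoodMetric

namespace CategoryTheory.Triangulated.TStructure

variable {T : Type u} [Category.{v} T] [Preadditive T] [HasZeroObject T] [HasShift T ℤ]
  [∀ n : ℤ, (shiftFunctor T n).Additive] [Pretriangulated T] (t : TStructure T)

/-- The t-structure is nondegenerate: `⋂ₙ T^{≤n} = 0` and `⋂ₙ T^{≥n} = 0`. -/
def Nondegenerate : Prop :=
  (∀ X : T, (∀ n : ℤ, t.le n X) → IsZero X) ∧ (∀ X : T, (∀ n : ℤ, t.ge n X) → IsZero X)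

/-- For a triangulated subcategory `P` of `T`, the metric `{P ∩ T^{≥i}}ᵢ` on `P`. -/
def metricOn (P : ObjectProperty T) [P.IsTriangulated] : GoodMetric P.FullSubcategory where
  ball i X := t.ge (i : ℤ) X.obj
  zero_mem i Z hZ := (t.isGE_of_isZero (P.ι.map_isZero hZ) i).ge
  ext_mem i D hD h₁ h₃ := (t.isGE₂ _ (P.ι.map_distinguished D hD) i ⟨h₁⟩ ⟨h₃⟩).ge
  anti i X hX := t.ge_antitone (by push_cast; omega) _ hX
  shift_mem i X hX :=
    (t.ge (i : ℤ)).prop_of_iso ((P.ι.commShiftIso (1 : ℤ)).symm.app X)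
      (t.ge_shift ((i + 1 : ℕ) : ℤ) 1 i (by push_cast; omega) X.obj hX)
  shift_neg_mem i X hX :=
    (t.ge (i : ℤ)).prop_of_iso ((P.ι.commShiftIso (-1 : ℤ)).symm.app X)
      (t.ge_antitone (by omega) _
        (t.ge_shift ((i + 1 : ℕ) : ℤ) (-1) ((i : ℤ) + 2) (by push_cast; omega) X.obj hX))

end CategoryTheory.Triangulated.TStructure

end

/-!
Write `T` for the ambient category, `P` for `T^b` or `T^-`, and `Mᵢ = P ∩ T^{≥i}`. Everything is
expressed through morphisms whose cone lies in `T^{≥n}`, that is `(t.ge n).trW f`: such a morphism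
is detected by maps out of objects of `T^{≤n}`, and a Cauchy sequence in `P` is a sequence whose
transition maps eventually have their cones in every given `T^{≥n}`.

The hypothesis on coproducts says that countable coproducts lose at most `r` in the lower bound.
Since `1 - shift` is split on a constant sequence, comparing a Cauchy sequence with the constant
sequence on one of its terms shows that the maps `aᵢ ⟶ C` to the homotopy colimit have their cones
in `T^{≥n}` for `i ≫ 0` (`trW_ge_hocolim`). As the objects of `P` are bounded above, this means
that `colim Y(a)` is the functor `Hom(-, C)` restricted to `P`. With nondegeneracy it also shows
that every object is the homotopy colimit of its truncations `X^{<k}`, so vanishing of `Hom(-, C)`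
on the bounded above objects of `T^{≥n}` gives vanishing on all of `T^{≥n+1}`
(`eq_zero_of_truncLT`); one degree is lost to the suspension in the homotopy colimit triangle.

The metric is very good by truncation. If it is excellent, the homotopy colimit `C` of the Cauchy
sequence attached to `B` lies in `(T^{≥n})^⊥`, and a type-`0` morphism makes the cone of `B ⟶ C`
lie in `T^{≥0}`, so that rotating gives the triangle `A ⟶ B ⟶ C` with `A ∈ T^{≥1}`
(`exists_hasApproximation_of_isExcellent`).

Conversely, shifting and iterating the triangles (`HasApproximation.of_shift`,
`HasApproximation.iterate`) makes the cone of `B ⟶ C` lie in `T^{≥m}` for any `m`, with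
`C ∈ (T^{≥n'})^⊥` for some `n'` depending on `m` only. In the bounded case the shift needed to
bring `B` into `T^{≥0}` depends on `B`, and must be undone: `A` is approximated again and again,
which needs approximations of unbounded objects of `T^{≥0}`; these are obtained from a truncation
(`hasApproximation_of_ge_zero`). The truncations of `C` are then a Cauchy sequence in `P` with
colimit `Hom(-, C)`, as excellence demands (`exists_type_of_approximation`).
-/

noncomputable section

namespace CategoryTheory.Pretriangulated

/-! ### Countable coproducts and the map `1 - shift` -/

section ShiftedCoproducts

variable {T : Type u} [Category.{v} T] [HasShift T ℤ] {J : Type*} (X : J → T) [HasCoproduct X]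

lemma sigma_shift_hom_ext (n : ℤ) {Z : T} {f g : (∐ X)⟦n⟧ ⟶ Z}
    (hfg : ∀ j, (Limits.Sigma.ι X j)⟦n⟧' ≫ f = (Limits.Sigma.ι X j)⟦n⟧' ≫ g) : f = g :=
  Cofan.IsColimit.hom_ext
    (isColimitOfHasCoproductOfPreservesColimit (shiftFunctor T n) X) _ _ hfg

lemma exists_sigma_shift_desc (n : ℤ) {Z : T} (f : ∀ j, (X j)⟦n⟧ ⟶ Z) :
    ∃ φ : (∐ X)⟦n⟧ ⟶ Z, ∀ j, (Limits.Sigma.ι X j)⟦n⟧' ≫ φ = f j :=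
  ⟨Cofan.IsColimit.desc (isColimitOfHasCoproductOfPreservesColimit (shiftFunctor T n) X) f,
    fun j => Cofan.IsColimit.fac
      (isColimitOfHasCoproductOfPreservesColimit (shiftFunctor T n) X) f j⟩

end ShiftedCoproducts

section OneSubShift

variable {T : Type u} [Category.{v} T] [Preadditive T] [HasCountableCoproducts T]

/-- The morphism `1 - shift : ∐ X ⟶ ∐ X` attached to a sequence `X₀ ⟶ X₁ ⟶ X₂ ⟶ ⋯`. -/
def oneSubShift (X : ℕ → T) (φ : ∀ j, X j ⟶ X (j + 1)) : ∐ X ⟶ ∐ X :=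
  Limits.Sigma.desc fun j => Limits.Sigma.ι X j - φ j ≫ Limits.Sigma.ι X (j + 1)

lemma ι_oneSubShift (X : ℕ → T) (φ : ∀ j, X j ⟶ X (j + 1)) (j : ℕ) :
    Limits.Sigma.ι X j ≫ oneSubShift X φ =
      Limits.Sigma.ι X j - φ j ≫ Limits.Sigma.ι X (j + 1) := by
  simp [oneSubShift]

lemma ι_oneSubShift_assoc (X : ℕ → T) (φ : ∀ j, X j ⟶ X (j + 1)) (j : ℕ) {Z : T}
    (f : ∐ X ⟶ Z) : Limits.Sigma.ι X j ≫ oneSubShift X φ ≫ f =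
      (Limits.Sigma.ι X j - φ j ≫ Limits.Sigma.ι X (j + 1)) ≫ f := by
  rw [← Category.assoc, ι_oneSubShift]

/-- For a constant sequence `1 - shift` is a split monomorphism. -/
lemma exists_retraction_oneSubShift_const (A : T) :
    ∃ ρ : (∐ fun _ : ℕ => A) ⟶ ∐ fun _ : ℕ => A,
      oneSubShift (fun _ => A) (fun _ => 𝟙 A) ≫ ρ = 𝟙 _ := by
  refine ⟨Limits.Sigma.desc fun j => -∑ k ∈ Finset.range j, Limits.Sigma.ι (fun _ : ℕ => A) k, ?_⟩
  ext j
  rw [ι_oneSubShift_assoc, Preadditive.sub_comp, Category.id_comp,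
    Limits.Sigma.ι_desc, Limits.Sigma.ι_desc, Finset.sum_range_succ]
  simp

end OneSubShift

variable {T : Type u} [Category.{v} T] [Preadditive T] [HasZeroObject T] [HasShift T ℤ]
  [∀ n : ℤ, (shiftFunctor T n).Additive] [Pretriangulated T]

/-! ### Exactness of distinguished triangles -/

section Exactness

variable {X Y Z : T} {f : X ⟶ Y} {g : Y ⟶ Z} {h : Z ⟶ X⟦(1 : ℤ)⟧}

lemma distTriang_comp₁₂ (H : Triangle.mk f g h ∈ distTriang T) : f ≫ g = 0 :=
  comp_distTriang_mor_zero₁₂ _ H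

lemma distTriang_comp₃₁ (H : Triangle.mk f g h ∈ distTriang T) : h ≫ f⟦(1 : ℤ)⟧' = 0 :=
  comp_distTriang_mor_zero₃₁ _ H

lemma distTriang_desc₂ (H : Triangle.mk f g h ∈ distTriang T) {A : T} (a : Y ⟶ A)
    (ha : f ≫ a = 0) : ∃ b : Z ⟶ A, a = g ≫ b :=
  Triangle.yoneda_exact₂ _ H a ha

lemma distTriang_desc₃ (H : Triangle.mk f g h ∈ distTriang T) {A : T} (a : Z ⟶ A)
    (ha : g ≫ a = 0) : ∃ b : X⟦(1 : ℤ)⟧ ⟶ A, a = h ≫ b :=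
  Triangle.yoneda_exact₃ _ H a ha

lemma distTriang_desc₁ (H : Triangle.mk f g h ∈ distTriang T) {A : T} (a : X⟦(1 : ℤ)⟧ ⟶ A)
    (ha : h ≫ a = 0) : ∃ b : Y⟦(1 : ℤ)⟧ ⟶ A, a = f⟦(1 : ℤ)⟧' ≫ b := by
  obtain ⟨b, hb⟩ := Triangle.yoneda_exact₃ _ (rot_of_distTriang _ H) a ha
  refine ⟨-b, hb.trans ?_⟩
  exact (Preadditive.neg_comp (f⟦(1 : ℤ)⟧') b).trans (Preadditive.comp_neg (f⟦(1 : ℤ)⟧') b).symm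

lemma distTriang_lift₁ (H : Triangle.mk f g h ∈ distTriang T) {A : T} (a : A ⟶ X⟦(1 : ℤ)⟧)
    (ha : a ≫ f⟦(1 : ℤ)⟧' = 0) : ∃ b : A ⟶ Z, a = b ≫ h :=
  Triangle.coyoneda_exact₁ _ H a ha

lemma distTriang_lift₂ (H : Triangle.mk f g h ∈ distTriang T) {A : T} (a : A ⟶ Y)
    (ha : a ≫ g = 0) : ∃ b : A ⟶ X, a = b ≫ f :=
  Triangle.coyoneda_exact₂ _ H a ha

lemma distTriang_lift₃ (H : Triangle.mk f g h ∈ distTriang T) {A : T} (a : A ⟶ Z)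
    (ha : a ≫ h = 0) : ∃ b : A ⟶ Y, a = b ≫ g :=
  Triangle.coyoneda_exact₃ _ H a ha

lemma distTriang_map (H : Triangle.mk f g h ∈ distTriang T) {X' Y' Z' : T} {f' : X' ⟶ Y'}
    {g' : Y' ⟶ Z'} {h' : Z' ⟶ X'⟦(1 : ℤ)⟧} (H' : Triangle.mk f' g' h' ∈ distTriang T)
    (a : X ⟶ X') (b : Y ⟶ Y') (comm : f ≫ b = a ≫ f') :
    ∃ c : Z ⟶ Z', g ≫ c = b ≫ g' ∧ h ≫ a⟦(1 : ℤ)⟧' = c ≫ h' :=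
  complete_distinguished_triangle_morphism _ _ H H' a b comm

lemma distTriang_of_iso₃ (H : Triangle.mk f g h ∈ distTriang T) {Z' : T} (e : Z ≅ Z') :
    Triangle.mk f (g ≫ e.hom) (e.inv ≫ h) ∈ distTriang T := by
  refine isomorphic_distinguished _ H _
    (Triangle.isoMk _ _ (Iso.refl _) (Iso.refl _) e.symm ?_ ?_ ?_)
  · exact (Category.comp_id f).trans (Category.id_comp f).symm
  · exact (show (g ≫ e.hom) ≫ e.inv = 𝟙 Y ≫ g by simp)
  · exact (show (e.inv ≫ h) ≫ (𝟙 X)⟦(1 : ℤ)⟧' = e.inv ≫ h by simp)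

end Exactness

/-- The cone of a coproduct of morphisms is a retract of the coproduct of the cones. (They are
isomorphic, but the splitting is all that is needed.) -/
lemma exists_retract_of_sigmaMap {J : Type*} {A X E : J → T} [HasCoproduct A] [HasCoproduct X]
    [HasCoproduct E] {f : ∀ j, A j ⟶ X j} {g : ∀ j, X j ⟶ E j} {h : ∀ j, E j ⟶ (A j)⟦(1 : ℤ)⟧}
    (H : ∀ j, Triangle.mk (f j) (g j) (h j) ∈ distTriang T) {Q : T} {p : ∐ X ⟶ Q}
    {q : Q ⟶ (∐ A)⟦(1 : ℤ)⟧} (HQ : Triangle.mk (Limits.Sigma.map f) p q ∈ distTriang T) :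
    ∃ (i : Q ⟶ ∐ E) (r : ∐ E ⟶ Q), i ≫ r = 𝟙 Q := by
  choose θ hθ₁ hθ₂ using fun j =>
    distTriang_map (H j) HQ (Limits.Sigma.ι A j) (Limits.Sigma.ι X j) (by simp)
  have : Epi (Limits.Sigma.desc θ) := by
    refine (Preadditive.epi_iff_cancel_zero _).2 fun Z a ha => ?_
    have ha' (j : J) : θ j ≫ a = 0 := by
      rw [← Limits.Sigma.ι_desc θ j, Category.assoc, ha, comp_zero]
    obtain ⟨b, rfl⟩ := distTriang_desc₃ HQ a (by
      ext j
      rw [← Category.assoc, ← hθ₁, Category.assoc, ha', comp_zero, comp_zero])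
    choose c hc using fun j => distTriang_desc₁ (H j) ((Limits.Sigma.ι A j)⟦(1 : ℤ)⟧' ≫ b) (by
      rw [← Category.assoc, hθ₂, Category.assoc, ha'])
    obtain ⟨φ, hφ⟩ := exists_sigma_shift_desc X 1 c
    have : b = (Limits.Sigma.map f)⟦(1 : ℤ)⟧' ≫ φ := by
      refine sigma_shift_hom_ext A 1 fun j => ?_
      rw [hc, ← Category.assoc, ← Functor.map_comp, Limits.Sigma.ι_map, Functor.map_comp,
        Category.assoc, hφ]
    rw [this, ← Category.assoc, distTriang_comp₃₁ HQ, zero_comp]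
  have := isSplitEpi_of_epi (Limits.Sigma.desc θ)
  exact ⟨section_ (Limits.Sigma.desc θ), Limits.Sigma.desc θ, IsSplitEpi.id _⟩

/-! ### Homotopy colimits of sequences -/

section Hocolim

variable [HasCountableCoproducts T]

/-- The object `W`, with the structure maps `c j : X j ⟶ W`, is a homotopy colimit (in the sense
of Bökstedt and Neeman) of the sequence `X₀ ⟶ X₁ ⟶ X₂ ⟶ ⋯`: the map `∐ X ⟶ W` with
components `c j` completes `1 - shift` to a distinguished triangle. -/
def IsHocolim (X : ℕ → T) (φ : ∀ j, X j ⟶ X (j + 1)) (W : T) (c : ∀ j, X j ⟶ W) : Prop :=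
  ∃ δ : W ⟶ (∐ X)⟦(1 : ℤ)⟧,
    Triangle.mk (oneSubShift X φ) (Limits.Sigma.desc c) δ ∈ distTriang T

lemma exists_isHocolim (X : ℕ → T) (φ : ∀ j, X j ⟶ X (j + 1)) :
    ∃ (W : T) (c : ∀ j, X j ⟶ W), IsHocolim X φ W c := by
  obtain ⟨W, p, δ, H⟩ := distinguished_cocone_triangle (oneSubShift X φ)
  refine ⟨W, fun j => Limits.Sigma.ι X j ≫ p, δ, ?_⟩
  convert H
  ext j
  simp

namespace IsHocolim

variable {X : ℕ → T} {φ : ∀ j, X j ⟶ X (j + 1)} {W : T} {c : ∀ j, X j ⟶ W}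

lemma comp_eq (hW : IsHocolim X φ W c) (j : ℕ) : φ j ≫ c (j + 1) = c j := by
  obtain ⟨δ, H⟩ := hW
  have := Limits.Sigma.ι X j ≫= distTriang_comp₁₂ H
  rw [ι_oneSubShift_assoc, Preadditive.sub_comp, comp_zero, Category.assoc, Limits.Sigma.ι_desc,
    Limits.Sigma.ι_desc, sub_eq_zero] at this
  exact this.symm

lemma exists_desc (hW : IsHocolim X φ W c) {Z : T} (a : ∀ j, X j ⟶ Z)
    (ha : ∀ j, φ j ≫ a (j + 1) = a j) : ∃ b : W ⟶ Z, ∀ j, c j ≫ b = a j := by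
  obtain ⟨δ, H⟩ := hW
  obtain ⟨b, hb⟩ := distTriang_desc₂ H (Limits.Sigma.desc a) (by
    ext j
    rw [ι_oneSubShift_assoc, Preadditive.sub_comp, Category.assoc,
      Limits.Sigma.ι_desc, Limits.Sigma.ι_desc, ha, sub_self, comp_zero])
  exact ⟨b, fun j => by rw [← Limits.Sigma.ι_desc c j, Category.assoc, ← hb, Limits.Sigma.ι_desc]⟩

lemma hom_eq_zero (hW : IsHocolim X φ W c) {Z : T} (h₀ : ∀ (j : ℕ) (f : X j ⟶ Z), f = 0)
    (h₁ : ∀ (j : ℕ) (f : (X j)⟦(1 : ℤ)⟧ ⟶ Z), f = 0) (f : W ⟶ Z) : f = 0 := by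
  obtain ⟨δ, H⟩ := hW
  obtain ⟨b, rfl⟩ := distTriang_desc₃ H f (by
    ext j
    rw [h₀ j (Limits.Sigma.ι X j ≫ Limits.Sigma.desc c ≫ f), comp_zero])
  have : b = 0 := sigma_shift_hom_ext X 1 fun j => by rw [h₁ j (_ ≫ b), comp_zero]
  rw [this, comp_zero]

/-- Dropping the first term of a sequence does not change its homotopy colimit: on
`∐ X = X₀ ⊕ ∐ X(· + 1)` the map `1 - shift` is, up to an automorphism, the direct sum of the
identity of `X₀` and the map `1 - shift` of the tail. -/
lemma tail (hW : IsHocolim X φ W c) :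
    IsHocolim (fun j => X (j + 1)) (fun j => φ (j + 1)) W (fun j => c (j + 1)) := by
  obtain ⟨δ, H⟩ := hW
  obtain ⟨W', c', δ', H'⟩ := exists_isHocolim (fun j => X (j + 1)) (fun j => φ (j + 1))
  let ι : (∐ fun j => X (j + 1)) ⟶ ∐ X := Limits.Sigma.desc fun j => Limits.Sigma.ι X (j + 1)
  -- `π₀` is the projection to the first summand, `ρ` the projection to the tail
  let π₀ : ∐ X ⟶ X 0 := Limits.Sigma.desc fun | 0 => 𝟙 _ | j + 1 => 0
  let ρ : ∐ X ⟶ ∐ fun j => X (j + 1) :=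
    Limits.Sigma.desc fun | 0 => 0 | j + 1 => Limits.Sigma.ι (fun j => X (j + 1)) j
  have hι (j : ℕ) : Limits.Sigma.ι (fun j => X (j + 1)) j ≫ ι = Limits.Sigma.ι X (j + 1) := by
    simp [ι]
  have hπ0 : Limits.Sigma.ι X 0 ≫ π₀ = 𝟙 _ := by simp [π₀]
  have hπS (j : ℕ) : Limits.Sigma.ι X (j + 1) ≫ π₀ = 0 := by simp [π₀]
  have hρ0 : Limits.Sigma.ι X 0 ≫ ρ = 0 := by simp [ρ]
  have hρS (j : ℕ) : Limits.Sigma.ι X (j + 1) ≫ ρ =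
      Limits.Sigma.ι (fun j => X (j + 1)) j := by simp [ρ]
  have hιρ : ι ≫ ρ = 𝟙 _ := by
    ext j; rw [← Category.assoc, hι, hρS, Category.comp_id]
  have hιπ : ι ≫ π₀ = 0 := by
    ext j; rw [← Category.assoc, hι, hπS, comp_zero]
  have hsum : 𝟙 _ = π₀ ≫ Limits.Sigma.ι X 0 + ρ ≫ ι := by
    ext j
    rw [Category.comp_id, Preadditive.comp_add]
    cases j with
    | zero => rw [← Category.assoc, hπ0, ← Category.assoc, hρ0]; simp
    | succ j => rw [← Category.assoc, hπS, ← Category.assoc, hρS, hι]; simp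
  have hsι : oneSubShift (fun j => X (j + 1)) (fun j => φ (j + 1)) ≫ ι = ι ≫ oneSubShift X φ := by
    ext j
    rw [ι_oneSubShift_assoc, ← Category.assoc, hι, ι_oneSubShift, Preadditive.sub_comp,
      Category.assoc, hι, hι]
  have hsπ : oneSubShift X φ ≫ π₀ = π₀ := by
    ext j
    rw [ι_oneSubShift_assoc, Preadditive.sub_comp, Category.assoc, hπS, comp_zero, sub_zero]
  -- the comparison `w` of the two homotopy colimits is shown to be mono and epi
  obtain ⟨w, hw₁, hw₂⟩ := distTriang_map H' H ι ι hsι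
  have hmono : Mono w := by
    refine (Preadditive.mono_iff_cancel_zero _).2 fun Z a ha => ?_
    obtain ⟨a', rfl⟩ := distTriang_lift₃ H' a (by
      have : (a ≫ δ') ≫ ι⟦(1 : ℤ)⟧' = 0 := by
        rw [Category.assoc, hw₂, ← Category.assoc, ha, zero_comp]
      rw [← Category.comp_id (a ≫ δ'), ← Functor.map_id, ← hιρ, Functor.map_comp,
        ← Category.assoc, this, zero_comp])
    obtain ⟨b, hb⟩ := distTriang_lift₂ H (a' ≫ ι) (by
      rw [Category.assoc, ← hw₁, ← Category.assoc, ha])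
    have hbπ : b ≫ π₀ = 0 := by
      rw [← hsπ, ← Category.assoc, ← hb, Category.assoc, hιπ, comp_zero]
    have hbι : b = (b ≫ ρ) ≫ ι := by
      rw [← Category.comp_id b, hsum, Preadditive.comp_add, ← Category.assoc b π₀, hbπ,
        zero_comp, zero_add]
      simp [hιρ]
    have : a' = (b ≫ ρ) ≫ oneSubShift (fun j => X (j + 1)) (fun j => φ (j + 1)) := by
      rw [← Category.comp_id a', ← hιρ, ← Category.assoc, hb, hbι, Category.assoc _ ι, ← hsι]
      simp [hιρ]
    rw [this, Category.assoc, distTriang_comp₁₂ H', comp_zero]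
  have hepi : Epi w := by
    refine (Preadditive.epi_iff_cancel_zero _).2 fun Z a ha => ?_
    have hcS (j : ℕ) : c (j + 1) ≫ a = 0 := by
      have := (Limits.Sigma.ι (fun j => X (j + 1)) j ≫= hw₁) =≫ a
      rw [Category.assoc, Category.assoc, ha, comp_zero, comp_zero, ← Category.assoc _ ι, hι,
        Limits.Sigma.ι_desc] at this
      exact this.symm
    have hc (j : ℕ) : c j ≫ a = 0 := by
      rw [← comp_eq ⟨δ, H⟩ j, Category.assoc, hcS, comp_zero]
    obtain ⟨b, rfl⟩ := distTriang_desc₃ H a (by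
      ext j; rw [← Category.assoc, Limits.Sigma.ι_desc, hc, comp_zero])
    obtain ⟨d, hd⟩ := distTriang_desc₁ H' (ι⟦(1 : ℤ)⟧' ≫ b) (by
      rw [← Category.assoc, hw₂, Category.assoc, ha])
    have hdj (j : ℕ) : (Limits.Sigma.ι X (j + 1))⟦(1 : ℤ)⟧' ≫ b =
        (Limits.Sigma.ι (fun j => X (j + 1)) j)⟦(1 : ℤ)⟧' ≫ d -
          (φ (j + 1))⟦(1 : ℤ)⟧' ≫ (Limits.Sigma.ι (fun j => X (j + 1)) (j + 1))⟦(1 : ℤ)⟧' ≫ d := by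
      rw [← hι, Functor.map_comp, Category.assoc, hd, ← Category.assoc, ← Functor.map_comp,
        ι_oneSubShift, Functor.map_sub, Preadditive.sub_comp, Functor.map_comp, Category.assoc]
    -- extend `d` to the first summand so that `b` factors through `1 - shift`
    obtain ⟨e, he⟩ := exists_sigma_shift_desc X 1 (fun
      | 0 => (Limits.Sigma.ι X 0)⟦(1 : ℤ)⟧' ≫ b +
          (φ 0)⟦(1 : ℤ)⟧' ≫ (Limits.Sigma.ι (fun j => X (j + 1)) 0)⟦(1 : ℤ)⟧' ≫ d
      | j + 1 => (Limits.Sigma.ι (fun j => X (j + 1)) j)⟦(1 : ℤ)⟧' ≫ d)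
    have : b = (oneSubShift X φ)⟦(1 : ℤ)⟧' ≫ e := by
      refine sigma_shift_hom_ext X 1 fun j => ?_
      rw [← Category.assoc, ← Functor.map_comp, ι_oneSubShift, Functor.map_sub,
        Preadditive.sub_comp, Functor.map_comp, Category.assoc, he, he]
      cases j with
      | zero => simp
      | succ j => simpa using hdj j
    rw [this, ← Category.assoc, distTriang_comp₃₁ H, zero_comp]
  have := isSplitEpi_of_epi w
  have hiso : IsIso w := isIso_of_mono_of_isSplitEpi w
  have hc' : (Limits.Sigma.desc fun j => c (j + 1)) = Limits.Sigma.desc c' ≫ w := by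
    rw [hw₁]
    ext j
    rw [← Category.assoc, hι, Limits.Sigma.ι_desc, Limits.Sigma.ι_desc]
  refine ⟨inv w ≫ δ', ?_⟩
  rw [hc']
  exact distTriang_of_iso₃ H' (asIso w)

lemma tail_add {d : ℕ ⥤ T} {W : T} {c : ∀ j, d.obj j ⟶ W}
    (hW : IsHocolim d.obj (fun j => d.map (homOfLE j.le_succ)) W c) (i : ℕ) :
    IsHocolim (fun j => d.obj (j + i)) (fun j => d.map (homOfLE (by omega))) W
      (fun j => c (j + i)) := by
  induction i generalizing d with
  | zero => exact hW
  | succ i hi =>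
    exact hi (d := (show Monotone (fun j : ℕ => j + 1) from
      fun _ _ h => Nat.succ_le_succ h).functor ⋙ d) hW.tail

end IsHocolim

end Hocolim

end CategoryTheory.Pretriangulated

namespace CategoryTheory.Triangulated.TStructure

variable {T : Type u} [Category.{v} T] [Preadditive T] [HasZeroObject T] [HasShift T ℤ]
  [∀ n : ℤ, (shiftFunctor T n).Additive] [Pretriangulated T] (t : TStructure T)

/-! ### Morphisms whose cone lies in `T^{≥n}` -/

section ConeGE

variable {t} {A B C : T} {f : A ⟶ B} {g : B ⟶ C} {n k : ℤ}

lemma eq_zero_of_le_of_ge {f : A ⟶ B} (hA : t.le k A) (hB : t.ge n B) (hk : k < n) : f = 0 :=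
  t.zero_of_isLE_of_isGE f k n hk ⟨hA⟩ ⟨hB⟩

lemma ge_of_forall_eq_zero (h : ∀ (Y : T) (f : Y ⟶ A), t.le (n - 1) Y → f = 0) : t.ge n A :=
  ((t.isGE_iff_orthogonal (n - 1) n (by omega) A).2 fun Y f hY => h Y f hY.le).ge

lemma trW_ge_mono (hf : (t.ge n).trW f) (hk : k ≤ n) : (t.ge k).trW f :=
  ObjectProperty.trW_monotone (t.ge_antitone hk) _ hf

lemma exists_lift_of_trW_ge (hf : (t.ge n).trW f) {Y : T} (hY : t.le k Y) (hk : k < n)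
    (y : Y ⟶ B) : ∃ x : Y ⟶ A, x ≫ f = y := by
  obtain ⟨Z, g, h, H, hZ⟩ := hf
  obtain ⟨x, hx⟩ := distTriang_lift₂ H y (eq_zero_of_le_of_ge hY hZ hk)
  exact ⟨x, hx.symm⟩

lemma eq_zero_of_trW_ge (hf : (t.ge n).trW f) {Y : T} (hY : t.le k Y) (hk : k ≤ n)
    (x : Y ⟶ A) (hx : x ≫ f = 0) : x = 0 := by
  obtain ⟨Z, g, h, H, hZ⟩ := hf
  obtain ⟨z, hz⟩ := distTriang_lift₁ H (x⟦(1 : ℤ)⟧') (by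
    rw [← Functor.map_comp, hx, Functor.map_zero])
  rw [eq_zero_of_le_of_ge (f := z) (t.le_shift k 1 (k - 1) (by omega) Y hY) hZ (by omega),
    zero_comp] at hz
  exact (shiftFunctor T (1 : ℤ)).map_injective (hz.trans (Functor.map_zero _ _ _).symm)

/-- The converse of `exists_lift_of_trW_ge` and `eq_zero_of_trW_ge`. -/
lemma trW_ge_of_forall
    (hlift : ∀ (Y : T), t.le (n - 1) Y → ∀ y : Y ⟶ B, ∃ x : Y ⟶ A, x ≫ f = y)
    (hzero : ∀ (Y : T), t.le n Y → ∀ x : Y ⟶ A, x ≫ f = 0 → x = 0) : (t.ge n).trW f := by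
  obtain ⟨Z, g, h, H⟩ := distinguished_cocone_triangle f
  refine ⟨Z, g, h, H, ge_of_forall_eq_zero fun Y z hY => ?_⟩
  have hzh : z ≫ h = 0 := by
    have hzf : (z ≫ h) ≫ f⟦(1 : ℤ)⟧' = 0 := by
      rw [Category.assoc, distTriang_comp₃₁ H, comp_zero]
    let e := (shiftFunctorCompIsoId T (1 : ℤ) (-1) (by omega))
    have := hzero (Y⟦(-1 : ℤ)⟧) (t.le_shift (n - 1) (-1) n (by omega) Y hY)
      ((z ≫ h)⟦(-1 : ℤ)⟧' ≫ e.hom.app A) (by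
        have hn : (f⟦(1 : ℤ)⟧')⟦(-1 : ℤ)⟧' ≫ e.hom.app B = e.hom.app A ≫ f := e.hom.naturality f
        rw [Category.assoc, ← hn, ← Category.assoc, ← Functor.map_comp, hzf, Functor.map_zero,
          zero_comp])
    rw [← zero_comp (f := e.hom.app A), cancel_mono] at this
    exact (shiftFunctor T (-1 : ℤ)).map_injective (this.trans (Functor.map_zero _ _ _).symm)
  obtain ⟨y, rfl⟩ := distTriang_lift₃ H z hzh
  obtain ⟨x, rfl⟩ := hlift Y hY y
  rw [Category.assoc, distTriang_comp₁₂ H, comp_zero]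

lemma trW_ge_comp (hf : (t.ge n).trW f) (hg : (t.ge n).trW g) : (t.ge n).trW (f ≫ g) := by
  refine trW_ge_of_forall (fun Y hY z => ?_) (fun Y hY x hx => ?_)
  · obtain ⟨y, rfl⟩ := exists_lift_of_trW_ge hg hY (by omega) z
    obtain ⟨x, rfl⟩ := exists_lift_of_trW_ge hf hY (by omega) y
    exact ⟨x, (Category.assoc _ _ _).symm⟩
  · exact eq_zero_of_trW_ge hf hY le_rfl x
      (eq_zero_of_trW_ge hg hY le_rfl (x ≫ f) (by rw [Category.assoc, hx]))

lemma trW_ge_of_postcomp (hfg : (t.ge n).trW (f ≫ g)) (hg : (t.ge (n - 1)).trW g) :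
    (t.ge n).trW f := by
  refine trW_ge_of_forall (fun Y hY y => ?_) (fun Y hY x hx => ?_)
  · obtain ⟨x, hx⟩ := exists_lift_of_trW_ge hfg hY (by omega) (y ≫ g)
    refine ⟨x, sub_eq_zero.1 (eq_zero_of_trW_ge hg hY le_rfl _ ?_)⟩
    rw [Preadditive.sub_comp, Category.assoc, hx, sub_self]
  · exact eq_zero_of_trW_ge hfg hY le_rfl x (by rw [← Category.assoc, hx, zero_comp])

lemma trW_ge_of_precomp (hfg : (t.ge n).trW (f ≫ g)) (hf : (t.ge (n + 1)).trW f) :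
    (t.ge n).trW g := by
  refine trW_ge_of_forall (fun Y hY z => ?_) (fun Y hY y hy => ?_)
  · obtain ⟨x, rfl⟩ := exists_lift_of_trW_ge hfg hY (by omega) z
    exact ⟨x ≫ f, Category.assoc _ _ _⟩
  · obtain ⟨x, rfl⟩ := exists_lift_of_trW_ge hf hY (by omega) y
    rw [eq_zero_of_trW_ge hfg hY le_rfl x (by rw [← hy, Category.assoc]), zero_comp]

lemma trW_ge_shift (hf : (t.ge n).trW f) : (t.ge (n - 1)).trW (f⟦(1 : ℤ)⟧') := by
  obtain ⟨Z, g, h, H, hZ⟩ := hf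
  rw [← ObjectProperty.smul_mem_trW_iff _ _ ((1 : ℤ).negOnePow)]
  exact ⟨_, _, _, Triangle.shift_distinguished _ H 1, t.ge_shift n 1 (n - 1) (by omega) Z hZ⟩

lemma trW_ge_iff {h : C ⟶ A⟦(1 : ℤ)⟧} (H : Triangle.mk f g h ∈ distTriang T) :
    (t.ge n).trW f ↔ t.ge n C :=
  (t.ge n).trW_iff_of_distinguished _ H

/-- In a triangle `A ⟶ B ⟶ C`, the cone of `B ⟶ C` is the suspension of `A`. -/
lemma trW_ge_iff_ge_succ {h : C ⟶ A⟦(1 : ℤ)⟧} (H : Triangle.mk f g h ∈ distTriang T) :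
    (t.ge n).trW g ↔ t.ge (n + 1) A := by
  refine ((t.ge n).trW_iff_of_distinguished _ (rot_of_distTriang _ H)).trans ?_
  rw [ge_iff_isGE, ge_iff_isGE]
  exact t.isGE_shift_iff A (n + 1) 1 n

/-- In a nondegenerate t-structure, a morphism whose cone lies in every `T^{≥n}` is invertible. -/
lemma isIso_of_forall_trW_ge (ht : t.Nondegenerate) (hf : ∀ n : ℤ, (t.ge n).trW f) :
    IsIso f := by
  obtain ⟨Z, g, h, H⟩ := distinguished_cocone_triangle f
  exact (Triangle.isZero₃_iff_isIso₁ _ H).1 (ht.2 Z fun n => (trW_ge_iff H).1 (hf n))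

lemma trW_ge_truncLTι (X : T) : (t.ge n).trW ((t.truncLTι n).app X) :=
  ObjectProperty.trW.mk _ (t.triangleLTGE_distinguished n X) (t.isGE_truncGE_obj _ _ _).ge

end ConeGE

/-! ### Countable coproducts and homotopy colimits -/

section Countable

variable [HasCountableCoproducts T] {t} {r : ℤ}
  (hr : ∀ X : ℕ → T, (∀ i, t.ge r (X i)) → t.ge 0 (∐ X))
include hr

lemma ge_sigma {n : ℤ} {X : ℕ → T} (hX : ∀ i, t.ge n (X i)) : t.ge (n - r) (∐ X) := by
  have h := hr (fun i => (X i)⟦n - r⟧) fun i => t.ge_shift n (n - r) r (by omega) _ (hX i)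
  have : t.IsGE ((∐ X)⟦n - r⟧) 0 :=
    ⟨(t.ge 0).prop_of_iso (PreservesCoproduct.iso (shiftFunctor T (n - r)) X).symm h⟩
  exact (t.isGE_of_shift (∐ X) (n - r) (n - r) 0).ge

lemma trW_ge_sigmaMap {n : ℤ} {A X : ℕ → T} {f : ∀ j, A j ⟶ X j}
    (hf : ∀ j, (t.ge n).trW (f j)) : (t.ge (n - r)).trW (Limits.Sigma.map f) := by
  choose E g h H hE using hf
  obtain ⟨Q, p, q, HQ⟩ := distinguished_cocone_triangle (Limits.Sigma.map f)
  obtain ⟨i, s, his⟩ := exists_retract_of_sigmaMap H HQ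
  refine ⟨Q, p, q, HQ, ge_of_forall_eq_zero fun Y y hY => ?_⟩
  rw [← Category.comp_id y, ← his, ← Category.assoc,
    eq_zero_of_le_of_ge (f := y ≫ i) hY (ge_sigma hr hE) (by omega), zero_comp]

/-- If the maps `A ⟶ X j` from a fixed object to the terms of a sequence have their cones in
`T^{≥n}`, then the induced map from `A` to the homotopy colimit has its cone in
`T^{≥n-r-1}`. The proof compares the sequence with the constant sequence `A`, for which
`1 - shift` is split. -/
lemma trW_ge_hocolim_of_const {n : ℤ} {X : ℕ → T} {φ : ∀ j, X j ⟶ X (j + 1)} {W : T}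
    {c : ∀ j, X j ⟶ W} (hW : IsHocolim X φ W c) {A : T} (a : ∀ j, A ⟶ X j)
    (ha : ∀ j, a j ≫ φ j = a (j + 1)) (hn : ∀ j, (t.ge n).trW (a j)) :
    (t.ge (n - r - 1)).trW (a 0 ≫ c 0) := by
  have hac (j : ℕ) : a j ≫ c j = a 0 ≫ c 0 := by
    induction j with
    | zero => rfl
    | succ j hj => rw [← ha, Category.assoc, hW.comp_eq, hj]
  obtain ⟨δ, H⟩ := hW
  obtain ⟨ρ, hρ⟩ := exists_retraction_oneSubShift_const A
  -- `S` maps the constant sequence to `X`; the codiagonal `D` exhibits `A` as the homotopy colimit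
  -- of the constant sequence
  let S : (∐ fun _ : ℕ => A) ⟶ ∐ X := Limits.Sigma.map a
  let D : (∐ fun _ : ℕ => A) ⟶ A := Limits.Sigma.desc fun _ => 𝟙 A
  have hS : (t.ge (n - r)).trW S := trW_ge_sigmaMap hr hn
  have hιS (j : ℕ) : Limits.Sigma.ι (fun _ : ℕ => A) j ≫ S = a j ≫ Limits.Sigma.ι X j := by
    simp [S]
  have hιD (j : ℕ) : Limits.Sigma.ι (fun _ : ℕ => A) j ≫ D = 𝟙 A := by simp [D]
  have hcomm : S ≫ oneSubShift X φ = oneSubShift (fun _ => A) (fun _ => 𝟙 A) ≫ S := by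
    ext j
    rw [← Category.assoc, hιS, Category.assoc, ι_oneSubShift, ι_oneSubShift_assoc,
      Preadditive.comp_sub, Preadditive.sub_comp, hιS, Category.assoc, hιS, Category.id_comp,
      ← ha, Category.assoc]
  have hsD : oneSubShift (fun _ => A) (fun _ => 𝟙 A) ≫ D = 0 := by
    ext j
    rw [ι_oneSubShift_assoc, Preadditive.sub_comp, Category.assoc, hιD, hιD, Category.id_comp,
      sub_self, comp_zero]
  have hSc : S ≫ Limits.Sigma.desc c = D ≫ a 0 ≫ c 0 := by
    ext j
    rw [← Category.assoc, hιS, Category.assoc, Limits.Sigma.ι_desc, hac, ← Category.assoc, hιD,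
      Category.id_comp]
  refine trW_ge_of_forall (fun Y hY y => ?_) (fun Y hY x hx => ?_)
  · -- `y ≫ δ` lifts along `S` to a `z` killed by the split mono `1 - shift`
    have hyδ : y ≫ δ = 0 := by
      obtain ⟨z, hz⟩ := exists_lift_of_trW_ge (trW_ge_shift hS) hY (by omega) (y ≫ δ)
      have hz₀ : z ≫ (oneSubShift (fun _ => A) (fun _ => 𝟙 A))⟦(1 : ℤ)⟧' = 0 := by
        refine eq_zero_of_trW_ge (trW_ge_shift hS) hY (by omega) _ ?_
        rw [Category.assoc, ← Functor.map_comp, ← hcomm, Functor.map_comp, ← Category.assoc, hz,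
          Category.assoc, distTriang_comp₃₁ H, comp_zero]
      have : z = 0 := by
        rw [← Category.comp_id z, ← Functor.map_id, ← hρ, Functor.map_comp, ← Category.assoc,
          hz₀, zero_comp]
      rw [← hz, this, zero_comp]
    obtain ⟨y', rfl⟩ := distTriang_lift₃ H y hyδ
    obtain ⟨z, rfl⟩ := exists_lift_of_trW_ge hS hY (by omega) y'
    exact ⟨z ≫ D, by rw [Category.assoc, Category.assoc, hSc]⟩
  · -- `x`, placed in the `0`-th summand, is in the image of `1 - shift`, which `D` kills
    obtain ⟨b, hb⟩ := distTriang_lift₂ H (x ≫ Limits.Sigma.ι (fun _ : ℕ => A) 0 ≫ S) (by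
      rw [Category.assoc, Category.assoc, hSc, ← Category.assoc _ D, hιD, Category.id_comp, hx])
    obtain ⟨z, rfl⟩ := exists_lift_of_trW_ge hS hY (by omega) b
    have h0 : x ≫ Limits.Sigma.ι (fun _ : ℕ => A) 0 -
        z ≫ oneSubShift (fun _ => A) (fun _ => 𝟙 A) = 0 := by
      refine eq_zero_of_trW_ge hS hY (by omega) _ ?_
      rw [Preadditive.sub_comp, Category.assoc, Category.assoc, hb, Category.assoc, hcomm,
        sub_self]
    have := h0 =≫ D
    rw [Preadditive.sub_comp, Category.assoc, Category.assoc, hιD, hsD, comp_zero, sub_zero,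
      Category.comp_id, zero_comp] at this
    exact this

/-- If the transition maps out of the `i`-th term have their cones in `T^{≥n}`, then so does, up
to a fixed loss, the map from the `i`-th term to the homotopy colimit. -/
lemma trW_ge_hocolim {n : ℤ} {d : ℕ ⥤ T} {W : T} {c : ∀ j, d.obj j ⟶ W}
    (hW : IsHocolim d.obj (fun j => d.map (homOfLE j.le_succ)) W c) (i : ℕ)
    (hn : ∀ (j : ℕ) (hij : i ≤ j), (t.ge n).trW (d.map (homOfLE hij))) :
    (t.ge (n - r - 1)).trW (c i) := by
  have h := trW_ge_hocolim_of_const hr (hW.tail_add i)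
    (fun j => d.map (homOfLE (Nat.le_add_left i j)))
    (fun j => by rw [← Functor.map_comp, homOfLE_comp]) (fun j => hn _ _)
  have hc : d.map (homOfLE (Nat.le_add_left i 0)) ≫ c (0 + i) = c i := by
    have : ∀ (j : ℕ) (hj : j = i), d.map (homOfLE hj.ge) ≫ c j = c i := by
      rintro j rfl
      exact (congrArg (· ≫ c j) (d.map_id j)).trans (Category.id_comp _)
    exact this _ (Nat.zero_add i)
  rwa [hc] at h

end Countable

/-! ### Objects as homotopy colimits of their truncations -/

/-- The sequence `X^{<0} ⟶ X^{<1} ⟶ X^{<2} ⟶ ⋯` of truncations of `X`. -/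
def truncSeq (X : T) : ℕ ⥤ T where
  obj k := (t.truncLT k).obj X
  map {i j} f := (t.natTransTruncLTOfLE i j (by exact_mod_cast leOfHom f)).app X
  map_id i := t.natTransTruncLTOfLE_refl_app i X
  map_comp _ _ := (t.natTransTruncLTOfLE_trans_app _ _ _ _ _ X).symm

/-- The canonical morphism `X^{<k} ⟶ X`. -/
def truncSeqι (X : T) (k : ℕ) : (t.truncSeq X).obj k ⟶ X := (t.truncLTι k).app X

lemma truncSeq_map_ι (X : T) {i j : ℕ} (f : i ⟶ j) :
    (t.truncSeq X).map f ≫ t.truncSeqι X j = t.truncSeqι X i :=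
  t.natTransTruncLTOfLE_ι_app i j (by exact_mod_cast leOfHom f) X

variable {t}

lemma trW_ge_truncSeqι (X : T) (k : ℕ) : (t.ge k).trW (t.truncSeqι X k) :=
  trW_ge_truncLTι X

lemma trW_ge_truncSeq_map (X : T) {i j : ℕ} (hij : i ≤ j) :
    (t.ge i).trW ((t.truncSeq X).map (homOfLE hij)) := by
  refine trW_ge_of_postcomp (g := t.truncSeqι X j) ?_
    (trW_ge_mono (trW_ge_truncSeqι X j) (by omega))
  rw [truncSeq_map_ι]
  exact trW_ge_truncSeqι X i

/-- If the t-structure is nondegenerate and countable coproducts have bounded amplitude, every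
object is the homotopy colimit of its truncations; hence a morphism out of it vanishes if all
morphisms out of its truncations and of their suspensions do. -/
lemma eq_zero_of_truncLT [HasCountableCoproducts T] (ht : t.Nondegenerate) {r : ℤ}
    (hr : ∀ X : ℕ → T, (∀ i, t.ge r (X i)) → t.ge 0 (∐ X)) {X C : T}
    (h₀ : ∀ (k : ℕ) (f : (t.truncLT k).obj X ⟶ C), f = 0)
    (h₁ : ∀ (k : ℕ) (f : ((t.truncLT k).obj X)⟦(1 : ℤ)⟧ ⟶ C), f = 0) (f : X ⟶ C) : f = 0 := by
  obtain ⟨W, c, hW⟩ := exists_isHocolim (t.truncSeq X).obj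
    (fun j => (t.truncSeq X).map (homOfLE j.le_succ))
  obtain ⟨w, hw⟩ := hW.exists_desc (t.truncSeqι X)
    (fun j => t.truncSeq_map_ι X _)
  have : IsIso w := isIso_of_forall_trW_ge ht fun n => by
    obtain ⟨i, hi⟩ : ∃ i : ℕ, max n (n + 1 + r + 1) ≤ i :=
      ⟨(max n (n + 1 + r + 1)).toNat, Int.self_le_toNat _⟩
    refine trW_ge_of_precomp (f := c i) ?_ (trW_ge_mono
      (trW_ge_hocolim hr hW i fun j hij => trW_ge_truncSeq_map X hij) (by omega))
    rw [hw]
    exact trW_ge_mono (trW_ge_truncSeqι X i) (by omega)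
  rw [← cancel_epi w, hW.hom_eq_zero h₀ h₁ (w ≫ f), comp_zero]

end CategoryTheory.Triangulated.TStructure

/-! ### The restricted Yoneda functor -/

section RestrictedYoneda

variable {T : Type u} [Category.{v} T] [Preadditive T] (P : ObjectProperty T)

/-- The restricted Yoneda functor `T ⥤ Mod-P`, `C ↦ Hom(-, C)`, for a full subcategory `P`
of `T`. -/
def restrictedYoneda : T ⥤ ModCat P.FullSubcategory :=
  ObjectProperty.lift _ (preadditiveYoneda ⋙ (Functor.whiskeringLeft _ _ _).obj P.ι.op)
    (fun C => (inferInstance : (P.ι.op ⋙ preadditiveYoneda.obj C).Additive))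

/-- On `P` itself, the Yoneda functor maps to the restricted Yoneda functor of `T`. -/
def yonedaToRestricted : yonedaMod P.FullSubcategory ⟶ P.ι ⋙ restrictedYoneda P where
  app X := ⟨{
    app Y := AddCommGrpCat.ofHom
      { toFun := fun g : Y.unop ⟶ X => g.hom
        map_zero' := rfl
        map_add' := fun _ _ => rfl }
    naturality := fun _ _ _ => rfl }⟩
  naturality _ _ _ := rfl

variable {P}

/-- A morphism `Y(X) ⟶ Hom(-, C)` corresponds to a morphism `X ⟶ C`. -/
lemma yonedaMod_hom_restrictedYoneda_eq_zero {X : P.FullSubcategory} {C : T}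
    (f : (yonedaMod P.FullSubcategory).obj X ⟶ (restrictedYoneda P).obj C)
    (h : ∀ g : X.obj ⟶ C, g = 0) : f = 0 := by
  refine ObjectProperty.hom_ext _ (NatTrans.ext (funext fun Y => ?_))
  refine AddCommGrpCat.ext fun (y : Y.unop ⟶ X) => ?_
  have hn := congrArg (fun k => k.hom (𝟙 X)) (f.hom.naturality (Quiver.Hom.op y))
  have h0 : (f.hom.app (Opposite.op X)).hom (𝟙 X) = (0 : X.obj ⟶ C) := h _
  have hy : (f.hom.app Y).hom (y ≫ 𝟙 X) = (0 : Y.unop.obj ⟶ C) := by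
    refine hn.trans ?_
    change y.hom ≫ (f.hom.app (Opposite.op X)).hom (𝟙 X) = (0 : Y.unop.obj ⟶ C)
    rw [h0, comp_zero]
  rw [Category.comp_id] at hy
  exact hy

/-- The cocone with vertex `Hom(-, C)` over the Yoneda image of a sequence mapping to `C`. -/
def restrictedCocone (d : ℕ ⥤ P.FullSubcategory) {C : T}
    (α : d ⋙ P.ι ⟶ (Functor.const ℕ).obj C) : Cocone (d ⋙ yonedaMod P.FullSubcategory) where
  pt := (restrictedYoneda P).obj C
  ι :=
    { app := fun k => (yonedaToRestricted P).app (d.obj k) ≫ (restrictedYoneda P).map (α.app k)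
      naturality := fun i j f => by
        have h : (d.map f).hom ≫ α.app j = α.app i :=
          (α.naturality f).trans (Category.comp_id _)
        refine Eq.trans ?_ (Category.comp_id _).symm
        rw [← h, Functor.map_comp]
        exact (yonedaToRestricted P).naturality_assoc (d.map f) _ }

/-- A cocone over a sequence whose legs are eventually invertible is a colimit cocone. -/
lemma isColimit_of_eventually_isIso {D : Type*} [Category D] {F : ℕ ⥤ D} (c : Cocone F) (K : ℕ)
    (hK : ∀ k, K ≤ k → IsIso (c.ι.app k)) : Nonempty (IsColimit c) := by
  have := hK K le_rfl
  refine ⟨⟨fun s => inv (c.ι.app K) ≫ s.ι.app K, fun s j => ?_, fun s m hm => ?_⟩⟩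
  · have := hK (max j K) (le_max_right _ _)
    have h (s : Cocone F) {i k : ℕ} (hik : i ≤ k) :
        F.map (homOfLE hik) ≫ s.ι.app k = s.ι.app i := s.w _
    have hF : IsIso (F.map (homOfLE (le_max_right j K))) := by
      have e := h c (le_max_right j K)
      have : IsIso (F.map (homOfLE (le_max_right j K)) ≫ c.ι.app (max j K)) := by
        rw [e]; infer_instance
      exact IsIso.of_isIso_comp_right _ (c.ι.app (max j K))
    rw [← h c (le_max_left j K), ← h s (le_max_left j K), ← h s (le_max_right j K)]
    simp only [← h c (le_max_right j K), IsIso.inv_comp, Category.assoc, IsIso.inv_hom_id_assoc,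
      IsIso.hom_inv_id_assoc]
  · rw [← hm K, IsIso.inv_hom_id_assoc]

/-- If every object of `P` eventually sees the terms of the sequence `d` as `C`, then the colimit
of the Yoneda image of `d` is `Hom(-, C)`. -/
lemma isColimit_restrictedCocone (d : ℕ ⥤ P.FullSubcategory) {C : T}
    (α : d ⋙ P.ι ⟶ (Functor.const ℕ).obj C)
    (h : ∀ Y : P.FullSubcategory, ∃ K : ℕ, ∀ k, K ≤ k →
      Function.Bijective (fun y : Y.obj ⟶ (d.obj k).obj => (y ≫ α.app k : Y.obj ⟶ C))) :
    Nonempty (IsColimit (restrictedCocone d α)) := by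
  refine ⟨isColimitOfReflects (AdditiveFunctor.forget _ _)
    (evaluationJointlyReflectsColimits _ fun Y => Nonempty.some ?_)⟩
  obtain ⟨K, hK⟩ := h Y.unop
  refine isColimit_of_eventually_isIso _ K fun k hk => ?_
  refine (ConcreteCategory.isIso_iff_bijective _).2 ?_
  refine ((hK k hk).comp (f := fun y : Y.unop ⟶ d.obj k => y.hom) ?_ :)
  exact ⟨fun _ _ e => ObjectProperty.hom_ext _ e, fun y => ⟨ObjectProperty.homMk y, rfl⟩⟩

end RestrictedYoneda

/-! ### Cauchy sequences in a good metric -/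

namespace GoodMetric

lemma isColimit_constCocone {S : Type u} [Category.{v} S] [Preadditive S] (B : S) :
    Nonempty (IsColimit (constCocone B)) :=
  isColimit_of_eventually_isIso _ 0 fun _ _ =>
    inferInstanceAs (IsIso ((yonedaMod S).map (𝟙 B)))

variable {S : Type u} [Category.{v} S] [Preadditive S] [HasZeroObject S] [HasShift S ℤ]
  [∀ n : ℤ, (shiftFunctor S n).Additive] [Pretriangulated S] (M : GoodMetric S)

open scoped ZeroObject in
lemma trW_ball_of_isIso (n : ℕ) {X Y : S} (f : X ⟶ Y) [IsIso f] : (M.ball n).trW f :=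
  ⟨0, 0, 0, (Triangle.distinguished_iff_of_isZero₃ _ (isZero_zero S)).2 (inferInstanceAs (IsIso f)),
    M.zero_mem n _ (isZero_zero S)⟩

instance (n : ℕ) : (M.ball n).IsClosedUnderIsomorphisms where
  of_iso e hX := by
    obtain ⟨Z, g, h, H, hZ⟩ := M.trW_ball_of_isIso n e.hom
    exact M.ext_mem n _ H hX hZ

lemma trW_ball_comp [IsTriangulated S] {n : ℕ} {X Y Z : S} {f : X ⟶ Y} {g : Y ⟶ Z}
    (hf : (M.ball n).trW f) (hg : (M.ball n).trW g) : (M.ball n).trW (f ≫ g) := by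
  obtain ⟨C₁, a₁, b₁, H₁, h₁⟩ := hf
  obtain ⟨C₂, a₂, b₂, H₂, h₂⟩ := hg
  obtain ⟨C₃, a₃, b₃, H₃⟩ := distinguished_cocone_triangle (f ≫ g)
  exact ⟨C₃, a₃, b₃, H₃, M.ext_mem n _ (someOctahedron rfl H₁ H₂ H₃).mem h₁ h₂⟩

variable {M}

lemma isCauchy_iff {a : ℕ ⥤ S} : M.IsCauchy a ↔
    ∀ n : ℕ, ∃ N : ℕ, ∀ (i j : ℕ) (hij : i ≤ j), N ≤ i →
      (M.ball n).trW (a.map (homOfLE hij)) := by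
  refine forall_congr' fun n => exists_congr fun N => forall₄_congr fun i j hij hi => ?_
  constructor
  · intro h
    obtain ⟨D, g, k, H⟩ := distinguished_cocone_triangle (a.map (homOfLE hij))
    exact ⟨D, g, k, H, h D g k H⟩
  · intro h D g k H
    exact ((M.ball n).trW_iff_of_distinguished _ H).1 h

lemma isCauchy_constSeq (B : S) : M.IsCauchy (constSeq B) :=
  isCauchy_iff.2 fun n => ⟨0, fun _ _ _ _ => M.trW_ball_of_isIso n (𝟙 B)⟩

lemma IsCauchy.comp {a : ℕ ⥤ S} (ha : M.IsCauchy a) {q : ℕ → ℕ} (hq : StrictMono q) :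
    M.IsCauchy (hq.monotone.functor ⋙ a) :=
  isCauchy_iff.2 fun n => by
    obtain ⟨N, hN⟩ := isCauchy_iff.1 ha n
    exact ⟨N, fun i j hij hi => hN (q i) (q j) (hq.monotone hij) (hi.trans (hq.id_le i))⟩

/-- A morphism from a constant sequence to a Cauchy sequence can be completed to a sequence of
distinguished triangles whose third term is Cauchy: by the octahedral axiom, the cones of the
transition maps of the third term can be taken to be those of the second. -/
lemma exists_completion [IsTriangulated S] {B : S} {b : ℕ ⥤ S} (hb : M.IsCauchy b)
    (f : constSeq B ⟶ b) :
    ∃ (c : ℕ ⥤ S) (g : b ⟶ c) (h : c ⟶ constSeq B ⋙ shiftFunctor S (1 : ℤ)), M.IsCauchy c ∧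
      ∀ i, Triangle.mk (f.app i) (g.app i) (h.app i) ∈ distTriang S := by
  choose C v w H using fun i => distinguished_cocone_triangle (f.app i)
  have hcomm (i : ℕ) : f.app i ≫ b.map (homOfLE i.le_succ) = f.app (i + 1) :=
    (f.naturality (homOfLE i.le_succ)).symm.trans (Category.id_comp _)
  choose E p s K using fun i : ℕ => distinguished_cocone_triangle (b.map (homOfLE i.le_succ))
  let O (i : ℕ) := someOctahedron (hcomm i) (H i) (K i) (H (i + 1))
  let c : ℕ ⥤ S := Functor.ofSequence fun i => (O i).m₁
  have hc (i : ℕ) : c.map (homOfLE i.le_succ) = (O i).m₁ :=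
    Functor.ofSequence_map_homOfLE_succ _ i
  refine ⟨c, NatTrans.ofSequence v fun i => ?_, NatTrans.ofSequence w fun i => ?_, ?_, H⟩
  · exact (O i).comm₁.symm.trans (v i ≫= (hc i).symm)
  · have : (constSeq B ⋙ shiftFunctor S (1 : ℤ)).map (homOfLE i.le_succ) = 𝟙 _ :=
      (shiftFunctor S (1 : ℤ)).map_id B
    exact ((hc i =≫ w (i + 1)).trans (O i).comm₂).trans
      ((Category.comp_id (w i)).symm.trans (w i ≫= this.symm))
  · refine isCauchy_iff.2 fun n => ?_
    obtain ⟨N, hN⟩ := isCauchy_iff.1 hb n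
    refine ⟨N, fun i j hij hi => ?_⟩
    induction j, hij using Nat.le_induction with
    | base =>
      have : c.map (homOfLE (le_refl i)) = 𝟙 _ := c.map_id i
      rw [this]
      exact M.trW_ball_of_isIso n _
    | succ j hij ih =>
      rw [← homOfLE_comp hij j.le_succ, Functor.map_comp]
      refine M.trW_ball_comp ih ?_
      rw [hc]
      exact ⟨E j, _, _, (O j).mem,
        ((M.ball n).trW_iff_of_distinguished _ (K j)).1 (hN j _ j.le_succ (hi.trans hij))⟩

/-- Constant sequences exhibit `Y(Mₙ)` as a part of `𝓛ₙ`. -/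
lemma completionBall_yonedaMod {n : ℕ} {X : S} (hX : M.ball n X) :
    M.completionBall n ((yonedaMod S).obj X) :=
  ⟨constSeq X, isCauchy_constSeq X, fun _ => hX, (constCocone X).ι, isColimit_constCocone X⟩

end GoodMetric

namespace CategoryTheory.Triangulated.TStructure

variable {T : Type u} [Category.{v} T] [Preadditive T] [HasZeroObject T] [HasShift T ℤ]
  [∀ n : ℤ, (shiftFunctor T n).Additive] [Pretriangulated T] {t : TStructure T}

/-! ### Approximation by `T^{≥n}`-local objects -/

variable (t) in
/-- The object `B` has a distinguished triangle `A ⟶ B ⟶ C` with `A ∈ T^{≥a}` and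
`C ∈ (T^{≥n})^⊥`. -/
def HasApproximation (n a : ℤ) (B : T) : Prop :=
  ∃ (A C : T) (f : A ⟶ B) (g : B ⟶ C) (h : C ⟶ A⟦(1 : ℤ)⟧),
    Triangle.mk f g h ∈ distTriang T ∧ t.ge a A ∧ (t.ge n).rightOrthogonal C

lemma hasApproximation_iff {n a : ℤ} {B : T} : t.HasApproximation n (a + 1) B ↔
    ∃ (C : T) (g : B ⟶ C), (t.ge a).trW g ∧ (t.ge n).rightOrthogonal C := by
  constructor
  · rintro ⟨A, C, f, g, h, H, hA, hC⟩
    exact ⟨C, g, (trW_ge_iff_ge_succ H).2 hA, hC⟩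
  · rintro ⟨C, g, hg, hC⟩
    obtain ⟨A, f, h, H⟩ := distinguished_cocone_triangle₁ g
    exact ⟨A, C, f, g, h, H, (trW_ge_iff_ge_succ H).1 hg, hC⟩

lemma rightOrthogonal_ge_shift {n : ℤ} {C : T} (hC : (t.ge n).rightOrthogonal C) (k : ℤ) :
    (t.ge (n - k)).rightOrthogonal (C⟦k⟧) := by
  intro X x hX
  let e := shiftFunctorCompIsoId T k (-k) (by omega)
  have := hC (x⟦-k⟧' ≫ e.hom.app C) (t.ge_shift (n - k) (-k) n (by omega) X hX)
  rw [← zero_comp (f := e.hom.app C), cancel_mono] at this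
  exact (shiftFunctor T (-k)).map_injective (this.trans (Functor.map_zero _ _ _).symm)

lemma HasApproximation.of_shift {n a k : ℤ} {B : T} (h : t.HasApproximation n a (B⟦k⟧)) :
    t.HasApproximation (n + k) (a + k) B := by
  obtain ⟨A, C, f, g, h, H, hA, hC⟩ := h
  let e := shiftFunctorCompIsoId T k (-k) (by omega)
  have hC' : (t.ge (n + k)).rightOrthogonal (C⟦-k⟧) := by
    have := rightOrthogonal_ge_shift hC (-k)
    rwa [sub_neg_eq_add] at this
  have hg : (t.ge (a + k - 1)).trW (e.inv.app B ≫ g⟦-k⟧') := by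
    refine ((t.ge (a + k - 1)).trW.cancel_left_of_respectsIso _ _).2 ?_
    rw [← ObjectProperty.smul_mem_trW_iff _ _ ((-k).negOnePow)]
    exact (trW_ge_iff_ge_succ (Triangle.shift_distinguished _ H (-k))).2
      (t.ge_shift a (-k) _ (by omega) A hA)
  have := hasApproximation_iff.2 ⟨_, _, hg, hC'⟩
  rwa [sub_add_cancel] at this

/-- A morphism to an object of `(T^{≥n})^⊥` extends along a morphism with cone in
`T^{≥n-1}`. -/
lemma exists_extension_of_rightOrthogonal {n : ℤ} {X Y Z : T} {f : X ⟶ Y}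
    (hf : (t.ge (n - 1)).trW f) (hZ : (t.ge n).rightOrthogonal Z) (a : X ⟶ Z) :
    ∃ b : Y ⟶ Z, f ≫ b = a := by
  obtain ⟨E, g, h, H, hE⟩ := hf
  obtain ⟨b, hb⟩ := Triangle.yoneda_exact₂ _ (inv_rot_of_distTriang _ H) a
    (hZ _ (t.ge_shift (n - 1) (-1) n (by omega) E hE))
  exact ⟨b, hb.symm⟩

/-- Approximations of the bounded objects of `T^{≥0}` give approximations of all objects of
`T^{≥0}`: the approximation of a truncation `B^{<N}` extends to `B` for large `N`. -/
lemma hasApproximation_of_ge_zero [IsTriangulated T] {n : ℤ}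
    (hn : ∀ B : T, t.bounded B → t.ge 0 B → t.HasApproximation n 1 B) {B : T} (hB : t.ge 0 B) :
    t.HasApproximation n 1 B := by
  have : t.IsGE B 0 := ⟨hB⟩
  obtain ⟨C, g, hg, hC⟩ := (hasApproximation_iff (a := 0)).1
    (hn ((t.truncLT (max n 1)).obj B)
      (show t.plus _ ∧ t.minus _ from
        ⟨⟨0, inferInstance⟩, ⟨max n 1, t.isLE_truncLT_obj B _ _⟩⟩) (t.ge_of_isGE _ 0))
  have hι : (t.ge (max n 1)).trW ((t.truncLTι (max n 1)).app B) := trW_ge_truncLTι B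
  obtain ⟨g', hg'⟩ := exists_extension_of_rightOrthogonal (trW_ge_mono hι (by omega)) hC g
  exact (hasApproximation_iff (a := 0)).2
    ⟨C, g', trW_ge_of_precomp (hg'.symm ▸ hg) (trW_ge_mono hι (by omega)), hC⟩

/-- Approximations can be iterated: approximating the first term of an approximation triangle
improves the bound on it. -/
lemma HasApproximation.iterate [IsTriangulated T] {n : ℤ}
    (hn : ∀ B : T, t.ge 0 B → t.HasApproximation n 1 B) {B : T} (hB : t.ge 0 B) (k : ℕ) :
    t.HasApproximation (n + k) (1 + k) B := by
  induction k with
  | zero => simpa using hn B hB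
  | succ k ih =>
    obtain ⟨A, C, f, g, h, H, hA, hC⟩ := ih
    obtain ⟨A', C', f', g', h', H', hA', hC'⟩ :=
      (hn (A⟦(1 + k : ℤ)⟧) (t.ge_shift (1 + k) (1 + k) 0 (by omega) A hA)).of_shift
    obtain ⟨D, p, q, HD⟩ := distinguished_cocone_triangle (f' ≫ f)
    refine ⟨A', D, f' ≫ f, p, q, HD, t.ge_antitone (by push_cast; omega) _ hA', ?_⟩
    intro X x hX
    let O := someOctahedron rfl H' H HD
    obtain ⟨y, rfl⟩ := distTriang_lift₂ O.mem x
      (hC _ (t.ge_antitone (by push_cast; omega) _ hX))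
    rw [hC' y (t.ge_antitone (by push_cast; omega) _ hX), zero_comp]

/-! ### The metric on a subcategory of bounded above objects -/

section Metric

variable {P : ObjectProperty T} [P.IsTriangulated]

lemma trW_ge_iff_ball {X Y Z : P.FullSubcategory} {f : X ⟶ Y} {g : Y ⟶ Z}
    {h : Z ⟶ X⟦(1 : ℤ)⟧} (H : Triangle.mk f g h ∈ distTriang P.FullSubcategory) (n : ℕ) :
    (t.ge n).trW f.hom ↔ (t.metricOn P).ball n Z :=
  (t.ge n).trW_iff_of_distinguished _ (P.ι.map_distinguished _ H)

lemma trW_ball_iff {X Y : P.FullSubcategory} {f : X ⟶ Y} (n : ℕ) :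
    ((t.metricOn P).ball n).trW f ↔ (t.ge n).trW f.hom := by
  obtain ⟨Z, g, h, H⟩ := distinguished_cocone_triangle f
  exact (((t.metricOn P).ball n).trW_iff_of_distinguished _ H).trans (trW_ge_iff_ball H n).symm

lemma isVeryGood_metricOn [P.HasInducedTStructure t] (hP : P ≤ t.minus) :
    (t.metricOn P).IsVeryGood where
  exists_leftOrthogonal F := by
    obtain ⟨k, hk⟩ := hP _ F.property
    exact ⟨(k + 1).toNat, fun D f hD => ObjectProperty.hom_ext _
      (eq_zero_of_le_of_ge hk.le hD (by omega))⟩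
  exists_triangle m := by
    refine ⟨m + 1, m.lt_succ_self, fun F => ?_⟩
    obtain ⟨E, D, hE, hD, f, g, h, H⟩ :=
      (P.tStructure t).exists_triangle F (m - 1) m (by omega)
    exact ⟨E, D, f, g, h, H, fun D' f' hD' => ObjectProperty.hom_ext _
      (eq_zero_of_le_of_ge (n := ((m + 1 : ℕ) : ℤ)) (k := (m : ℤ) - 1) hE hD' (by omega)), hD⟩

end Metric

end CategoryTheory.Triangulated.TStructure

namespace CategoryTheory.Triangulated.TStructure

variable {T : Type u} [Category.{v} T] [Preadditive T] [HasZeroObject T] [HasShift T ℤ]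
  [∀ n : ℤ, (shiftFunctor T n).Additive] [Pretriangulated T] {t : TStructure T}
  {P : ObjectProperty T} [P.IsTriangulated]

/-! ### Excellence and approximations -/

/-- The maps from the terms of a Cauchy sequence to its homotopy colimit in `T` eventually have
their cones in every given `T^{≥m}`. -/
lemma exists_trW_ge_of_isCauchy [HasCountableCoproducts T] {r : ℤ}
    (hr : ∀ X : ℕ → T, (∀ i, t.ge r (X i)) → t.ge 0 (∐ X)) {d : ℕ ⥤ P.FullSubcategory}
    (hd : (t.metricOn P).IsCauchy d) {C : T} {c : ∀ j, (d ⋙ P.ι).obj j ⟶ C}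
    (hC : IsHocolim (d ⋙ P.ι).obj (fun j => (d ⋙ P.ι).map (homOfLE j.le_succ)) C c) (m : ℤ) :
    ∃ I : ℕ, ∀ i, I ≤ i → (t.ge m).trW (c i) := by
  obtain ⟨I, hI⟩ := GoodMetric.isCauchy_iff.1 hd (m + r + 1).toNat
  refine ⟨I, fun i hi => ?_⟩
  exact trW_ge_mono (trW_ge_hocolim hr hC i fun j hij => (trW_ball_iff _).1 (hI i j hij hi))
    (by omega)

/-- If the metric on `P` is excellent, every object of `P` can be approximated by an object of
`(T^{≥n})^⊥`, namely by the homotopy colimit in `T` of the Cauchy sequence provided by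
excellence. -/
lemma exists_hasApproximation_of_isExcellent [IsTriangulated T] [HasCountableCoproducts T]
    (ht : t.Nondegenerate) {r : ℤ} (hr : ∀ X : ℕ → T, (∀ i, t.ge r (X i)) → t.ge 0 (∐ X))
    (hP : P ≤ t.minus) (hP' : ∀ (X : T) (k : ℤ), t.plus X → P ((t.truncLT k).obj X))
    (h : (t.metricOn P).IsExcellent) :
    ∃ n : ℤ, 1 < n ∧ ∀ B : T, P B → t.HasApproximation n 1 B := by
  obtain ⟨n, hn, hF⟩ := h.exists_type 0
  refine ⟨n + 1, by omega, fun B hB => ?_⟩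
  obtain ⟨d, δ, hd, ⟨hδ⟩, -, horth, φ, p, q, hp, hq, f, -, hf⟩ := hF ⟨B, hB⟩
  obtain ⟨C, c, hC⟩ := exists_isHocolim (d ⋙ P.ι).obj
    (fun j => (d ⋙ P.ι).map (homOfLE j.le_succ))
  let α : d ⋙ P.ι ⟶ (Functor.const ℕ).obj C := NatTrans.ofSequence c fun j =>
    (hC.comp_eq j).trans (Category.comp_id _).symm
  have hcone := exists_trW_ge_of_isCauchy hr hd hC
  -- a morphism `X ⟶ C` factors through the sequence, where it dies in the colimit of `Y(d)`
  have hball (X : T) (hX : P X) (hXn : t.ge n X) (x : X ⟶ C) : x = 0 := by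
    obtain ⟨k, hk⟩ := hP X hX
    obtain ⟨i, hi⟩ := hcone (k + 1)
    obtain ⟨y, hy⟩ := exists_lift_of_trW_ge (hi i le_rfl) hk.le (by omega) x
    let X' : P.FullSubcategory := ⟨X, hX⟩
    let y' : X' ⟶ d.obj i := ObjectProperty.homMk y
    have h0 : (yonedaMod P.FullSubcategory).map y' ≫ δ.ι.app i = 0 :=
      horth _ (GoodMetric.completionBall_yonedaMod (X := X') hXn)
    have h1 : (yonedaMod P.FullSubcategory).map y' ≫ (restrictedCocone d α).ι.app i = 0 := by
      rw [← hδ.fac (restrictedCocone d α) i, ← Category.assoc, h0, zero_comp]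
    have h2 := congrArg (fun k => (k.hom.app (Opposite.op X')).hom (𝟙 X')) h1
    have h3 : (𝟙 X' ≫ y').hom ≫ α.app i = (0 : X ⟶ C) := h2
    rw [Category.id_comp] at h3
    rw [← hy]
    exact h3
  have horthC : (t.ge (n + 1 : ℤ)).rightOrthogonal C := by
    intro X x hX
    have : t.IsGE X (n + 1 : ℤ) := ⟨hX⟩
    refine eq_zero_of_truncLT ht hr (fun k y => ?_) (fun k y => ?_) x
    · exact hball _ (hP' X k ⟨_, this⟩)
        (t.ge_antitone (by omega) _ (t.ge_of_isGE ((t.truncLT k).obj X) (n + 1))) y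
    · exact hball _ (P.le_shift (1 : ℤ) _ (hP' X k ⟨_, this⟩))
        (t.ge_shift (n + 1) 1 n (by omega) _ (t.ge_of_isGE ((t.truncLT k).obj X) (n + 1))) y
  obtain ⟨e, u, w, he, H⟩ := GoodMetric.exists_completion (hd.comp hq) f
  obtain ⟨N, hN⟩ := hf e u w he H
  obtain ⟨I, hI⟩ := hcone 0
  refine (hasApproximation_iff (a := 0)).2
    ⟨C, (f.app (max N I)).hom ≫ c (q (max N I)), ?_, horthC⟩
  exact trW_ge_comp ((trW_ge_iff_ball (H (max N I)) 0).2 (hN _ (le_max_left _ _)))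
    (hI _ ((le_max_right _ _).trans (hq.id_le _)))

/-- Conversely, an approximation `C ∈ (T^{≥n})^⊥` of `F` whose truncations lie in `P` provides
what excellence asks of `F`: the Cauchy sequence of the truncations of `C`. -/
lemma exists_type_of_approximation (hP : P ≤ t.minus) {n m : ℕ} {F : P.FullSubcategory} {C : T}
    {g : F.obj ⟶ C} (hg : (t.ge m).trW g) (hC : (t.ge n).rightOrthogonal C)
    (hPC : ∀ k : ℕ, P ((t.truncLT k).obj C)) :
    ∃ (d : ℕ ⥤ P.FullSubcategory) (δ : Cocone (d ⋙ yonedaMod P.FullSubcategory)),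
      (t.metricOn P).IsCauchy d ∧ Nonempty (IsColimit δ) ∧
      (t.metricOn P).compactlySupported δ.pt ∧
      ((t.metricOn P).completionBall n).rightOrthogonal δ.pt ∧
      ∃ φ : (GoodMetric.constCocone F).pt ⟶ δ.pt,
        (t.metricOn P).IsType m (GoodMetric.constCocone F) δ φ := by
  let d : ℕ ⥤ P.FullSubcategory := P.lift (t.truncSeq C) hPC
  let α : d ⋙ P.ι ⟶ (Functor.const ℕ).obj C :=
    { app := t.truncSeqι C
      naturality := fun i j f => (t.truncSeq_map_ι C f).trans (Category.comp_id _).symm }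
  have hα (k : ℕ) : (t.ge k).trW (α.app k) := trW_ge_truncSeqι C k
  have hd : (t.metricOn P).IsCauchy d := GoodMetric.isCauchy_iff.2 fun N =>
    ⟨N, fun i j hij hi => (trW_ball_iff N).2
      (trW_ge_mono (trW_ge_truncSeq_map C hij) (by exact_mod_cast hi))⟩
  have hδ : Nonempty (IsColimit (restrictedCocone d α)) := by
    refine isColimit_restrictedCocone d α fun Y => ?_
    obtain ⟨k, hk⟩ := hP _ Y.property
    refine ⟨(k + 1).toNat, fun i hi => ⟨fun y₁ y₂ e => ?_, fun y => ?_⟩⟩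
    · refine sub_eq_zero.1 (eq_zero_of_trW_ge (hα i) hk.le (by omega) (y₁ - y₂) ?_)
      rw [Preadditive.sub_comp, sub_eq_zero]
      exact e
    · exact exists_lift_of_trW_ge (hα i) hk.le (by omega) y
  have hzero (X : P.FullSubcategory) (hX : (t.metricOn P).ball n X)
      (f : (yonedaMod P.FullSubcategory).obj X ⟶ (restrictedCocone d α).pt) : f = 0 :=
    yonedaMod_hom_restrictedYoneda_eq_zero f fun x => hC x hX
  refine ⟨d, restrictedCocone d α, hd, hδ,
    ⟨⟨d, hd, (restrictedCocone d α).ι, hδ⟩, n, hzero⟩, ?_, ?_⟩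
  · rintro E ψ ⟨a, -, ha, ε, ⟨hε⟩⟩
    exact hε.hom_ext fun i => (hzero (a.obj i) (ha i) _).trans comp_zero.symm
  · obtain ⟨k, hk⟩ := hP _ F.property
    obtain ⟨K, hK⟩ : ∃ K : ℕ, max (k + 1) m ≤ (K : ℤ) := ⟨_, Int.self_le_toNat _⟩
    obtain ⟨y, hy⟩ := exists_lift_of_trW_ge (hα K) hk.le (by omega) g
    let q : ℕ → ℕ := fun i => K + i
    have hq : StrictMono q := fun i j hij => Nat.add_lt_add_left hij K
    let y' : F ⟶ d.obj K := ObjectProperty.homMk y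
    let f : (strictMono_id (α := ℕ)).monotone.functor ⋙ GoodMetric.constSeq F ⟶
        hq.monotone.functor ⋙ d :=
      { app := fun i => y' ≫ d.map (homOfLE (Nat.le_add_right K i))
        naturality := fun i j e => by
          refine (Category.id_comp _).trans ?_
          refine Eq.trans ?_ (Category.assoc _ _ _).symm
          exact y' ≫= (d.map_comp _ _) }
    have hf (i : ℕ) : (f.app i).hom ≫ α.app (K + i) = g := by
      have : (d.map (homOfLE (Nat.le_add_right K i))).hom ≫ α.app (K + i) = α.app K :=
        t.truncSeq_map_ι C (homOfLE (Nat.le_add_right K i))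
      refine (Category.assoc y _ _).trans ?_
      exact (y ≫= this).trans hy
    refine ⟨(yonedaToRestricted P).app F ≫ (restrictedYoneda P).map g, id, q, strictMono_id, hq, f,
      fun i => ?_, fun c u w _ H => ⟨0, fun i _ => ?_⟩⟩
    · refine Eq.trans ?_ ((yonedaToRestricted P).naturality_assoc (f.app i)
        ((restrictedYoneda P).map (α.app (K + i)))).symm
      refine Eq.trans (((yonedaMod P.FullSubcategory).map_id F =≫ _).trans
        (Category.id_comp _)) ?_
      exact (yonedaToRestricted P).app F ≫=
        (((restrictedYoneda P).congr_map (hf i)).symm.trans (Functor.map_comp _ _ _))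
    · refine (trW_ge_iff_ball (H i) m).1 (trW_ge_of_postcomp (g := α.app (K + i)) ?_
        (trW_ge_mono (hα _) (by push_cast; omega)))
      exact (congrArg (fun x => (t.ge (m : ℤ)).trW x) (hf i)).mpr hg

/-- The metric on `P` is excellent if, up to a shift of the bounds independent of the object, the
objects of `P` have approximations whose truncations lie in `P`. -/
lemma isExcellent_of_hasApproximation [P.HasInducedTStructure t] (hP : P ≤ t.minus) (n : ℤ)
    (hn : ∀ (m : ℕ) (F : T), P F → t.HasApproximation (n + m) (1 + m) F)
    (hP' : ∀ (A B C : T) (f : A ⟶ B) (g : B ⟶ C) (h : C ⟶ A⟦(1 : ℤ)⟧),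
      Triangle.mk f g h ∈ distTriang T → t.plus A → P B → ∀ k : ℤ, P ((t.truncLT k).obj C)) :
    (t.metricOn P).IsExcellent where
  toIsVeryGood := isVeryGood_metricOn hP
  exists_type m := by
    refine ⟨max (n + m) (m + 1 : ℤ) |>.toNat, by omega, fun F => ?_⟩
    obtain ⟨A, C, f, g, h, H, hA, hC⟩ := hn m F.obj F.property
    exact exists_type_of_approximation hP
      ((trW_ge_iff_ge_succ H).2 (t.ge_antitone (by omega) _ hA))
      (fun X x hX => hC x (t.ge_antitone (by omega) _ hX))
      fun k => hP' A F.obj C f g h H ⟨_, ⟨hA⟩⟩ F.property k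

end CategoryTheory.Triangulated.TStructure

end

theorem proposition8 {T : Type u} [Category.{v} T] [Preadditive T] [HasZeroObject T]
    [HasShift T ℤ] [∀ n : ℤ, (shiftFunctor T n).Additive] [Pretriangulated T] [IsTriangulated T]
    [HasCountableCoproducts T] (t : TStructure T) (ht : t.Nondegenerate)
    (hr : ∃ r : ℤ, 0 < r ∧ ∀ X : ℕ → T, (∀ i, t.ge r (X i)) → t.ge 0 (∐ X)) :
    -- the metric `{T^b ∩ T^{≥i}}` on `T^b`
    ((t.metricOn t.bounded).IsVeryGood ∧
      ((t.metricOn t.bounded).IsExcellent ↔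
        ∃ n : ℤ, 1 < n ∧ ∀ B : T, t.bounded B → t.ge 0 B →
          ∃ (A C : T) (f : A ⟶ B) (g : B ⟶ C) (h : C ⟶ A⟦(1 : ℤ)⟧),
            Triangle.mk f g h ∈ distTriang T ∧ t.ge 1 A ∧
              t.plus C ∧ (t.ge n).rightOrthogonal C)) ∧
    -- the metric `{T^- ∩ T^{≥i}}` on `T^-`
    ((t.metricOn t.minus).IsVeryGood ∧
      ((t.metricOn t.minus).IsExcellent ↔
        ∃ n : ℤ, 1 < n ∧ ∀ B : T, t.minus B →
          ∃ (A C : T) (f : A ⟶ B) (g : B ⟶ C) (h : C ⟶ A⟦(1 : ℤ)⟧),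
            Triangle.mk f g h ∈ distTriang T ∧ t.ge 1 A ∧ (t.ge n).rightOrthogonal C)) := by
  obtain ⟨r, -, hr⟩ := hr
  have hbm : t.bounded ≤ t.minus := fun _ h => h.2
  refine ⟨⟨TStructure.isVeryGood_metricOn hbm, fun h => ?_, ?_⟩,
    ⟨TStructure.isVeryGood_metricOn le_rfl, fun h => ?_, ?_⟩⟩
  · obtain ⟨n, hn, H⟩ := TStructure.exists_hasApproximation_of_isExcellent ht hr hbm
      (fun X k hX => by
        obtain ⟨l, _⟩ := hX
        exact (show t.plus _ ∧ t.minus _ from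
          ⟨⟨l, inferInstance⟩, ⟨k, t.isLE_truncLT_obj X _ _⟩⟩)) h
    refine ⟨n, hn, fun B hB hB₀ => ?_⟩
    obtain ⟨A, C, f, g, w, hT, hA, hC⟩ := H B hB
    exact ⟨A, C, f, g, w, hT, hA, t.plus.ext_of_isTriangulatedClosed₃ _ hT ⟨1, ⟨hA⟩⟩ hB.1, hC⟩
  · rintro ⟨n, -, hn⟩
    have hn' (B : T) (hB : t.ge 0 B) : t.HasApproximation n 1 B :=
      TStructure.hasApproximation_of_ge_zero (fun B hB hB₀ => by
        obtain ⟨A, C, f, g, w, hT, hA, -, hC⟩ := hn B hB hB₀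
        exact ⟨A, C, f, g, w, hT, hA, hC⟩) hB
    refine TStructure.isExcellent_of_hasApproximation hbm n (fun m F hF => ?_) ?_
    · obtain ⟨l, hl⟩ := hF.1
      -- shift `F` into `T^{≥0}`, approximate there, and shift back
      obtain ⟨i, hi⟩ : ∃ i : ℕ, -l ≤ (i : ℤ) := ⟨_, Int.self_le_toNat _⟩
      have hFi : t.ge 0 (F⟦(-i : ℤ)⟧) :=
        t.ge_antitone (by omega) _ (t.ge_shift l (-i) (l + i) (by omega) F hl.ge)
      have := (TStructure.HasApproximation.iterate hn' hFi (m + i)).of_shift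
      rwa [show n + ((m + i : ℕ) : ℤ) + -(i : ℤ) = n + m by push_cast; ring,
        show 1 + ((m + i : ℕ) : ℤ) + -(i : ℤ) = 1 + m by push_cast; ring] at this
    · intro A B C f g w hT hA hB k
      obtain ⟨l, _⟩ : t.plus C := t.plus.ext_of_isTriangulatedClosed₃ _ hT hA hB.1
      exact (show t.plus _ ∧ t.minus _ from
        ⟨⟨l, inferInstance⟩, ⟨k, t.isLE_truncLT_obj C _ _⟩⟩)
  · exact TStructure.exists_hasApproximation_of_isExcellent ht hr le_rfl
      (fun X k _ => ⟨k, t.isLE_truncLT_obj X _ _⟩) h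
  · rintro ⟨n, -, hn⟩
    exact TStructure.isExcellent_of_hasApproximation le_rfl n
      (fun m F hF => TStructure.HasApproximation.of_shift
        (hn (F⟦(m : ℤ)⟧) (t.minus.le_shift (m : ℤ) _ hF)))
      fun A B C f g w _ _ _ k => ⟨k, t.isLE_truncLT_obj C _ _⟩
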